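/- **Setting.** An oriented ring consists of $n\ge 1$ processes $p_0,\dots,p_{n-1}$; port $0$ of $p_j$ leads to $p_{j+1}$ and port $1$ to $p_{j-1}$ (indices modulo $n$). Messages sent on port $0$ (and received on port $1$) are clockwise, those sent on port $1$ (and received on port $0$) counter-clockwise. Messages carry no content; the system is asynchronous (every delay is finite but unbounded), no message is lost or created, and messages that have arrived are buffered until they are received. The processes have pairwise distinct identifiers $\mathsf{ID}_0,\dots,\mathsf{ID}_{n-1}\in\mathbb N$, and each process knows only its own identifier and a common bound $U\ge n$ (but not $n$). Let $\mathsf{ID}_{\min}=\min_j \mathsf{ID}_j$. **Algorithm** $\mathrm{ElectionWithOneDirectionConstant}(\mathsf{ID},U)$, executed by every process. (A receive is blocking; "receive on port $q$" takes a message from either port and stores that port in $q$.) 1. Repeat $U\cdot \mathsf{ID}$ times: send on port $0$; receive on port $q$; if $q=0$, leave the loop. 2. If the loop was left with $q=0$: send on port $1$; receive on port $1$; then repeat (receive on port $q$; send on port $1-q$) until two messages have been received on port $0$ in this second loop; return Non-Leader. 3. Otherwise: send on port $1$; receive on port $0$; send on port $1$; then repeat (receive on port $q$; if $q=1$, send on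 port $0$) until $q=0$; send on port $1$; receive on port $0$; return Leader. **Theorem.** This algorithm is a quiescently terminating non-uniform leader election algorithm for oriented rings: for every $n\ge1$, every $U\ge n$, every choice of distinct identifiers and every asynchronous execution, all processes eventually reach a final state, Leader or Non-Leader; when they have all done so, exactly one of them is Leader, all others are Non-Leader, and no message is in transit. Moreover, the leader is the process with identifier $\mathsf{ID}_{\min}$, and each process sends exactly three counter-clockwise messages. If $\mathsf{ID}_{\min}\ge 1$, each process sends $O(U\cdot\mathsf{ID}_{\min})$ clockwise messages, and $O(n\cdot U\cdot \mathsf{ID}_{\min})$ messages are sent in total, where the constants in $O(\cdot)$ are absolute. -/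

import Mathlib

namespace ContentOblivious

/-- The two communication ports of a process. On an oriented ring, port `zero` leads to the
clockwise neighbour and port `one` to the counter-clockwise neighbour. -/
inductive Port where
  | zero
  | one
  deriving DecidableEq

/-- The other port (written `1 - q` for a port `q`). -/
def Port.other : Port → Port
  | .zero => .one
  | .one => .zero

/-- The two possible outcomes of a process. -/
inductive Output where
  | leader
  | nonLeader
  deriving DecidableEq

/-- What a process does next when its local state is known. Messages carry no content.
* `send p s`: send a message on port `p` and continue in state `s`;
* `receive next`: block until a message is available on some port `q` with `next q = some s`,
  take that message, and continue in state `s`; ports with `next q = none` are not listened to,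
  and their messages stay in the buffer;
* `halt o`: a final state with outcome `o`; nothing happens any more at this process. -/
inductive Action (σ : Type) where
  | send (p : Port) (s : σ)
  | receive (next : Port → Option σ)
  | halt (o : Output)

/-- Wait for a message on port `p` only, then continue in state `s`. -/
def Action.receiveOn {σ : Type} (p : Port) (s : σ) : Action σ :=
  .receive fun q => if q = p then some s else none

/-- Wait for a message on an arbitrary port `q`, then continue in state `next q`. -/
def Action.receiveAny {σ : Type} (next : Port → σ) : Action σ :=
  .receive fun q => some (next q)

/-- A deterministic, non-uniform, content-oblivious algorithm: every process starts in the state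
`init U ID`, which depends only on the known bound `U` and on its own identifier `ID`. -/
structure Algorithm where
  /-- local states of a process -/
  State : Type
  /-- initial state, from the bound on the size of the ring and the identifier -/
  init : ℕ → ℕ → State
  /-- the action taken in each state -/
  action : State → Action State

/-- In the oriented ring `(p_0, …, p_{n-1})`, port `0` of `p_j` leads to `p_{j+1}` and port `1`
leads to `p_{j-1}`, with indices modulo `n`. -/
def neighbor {n : ℕ} [NeZero n] (i : Fin n) : Port → Fin n
  | .zero => i + 1
  | .one => i - 1

/-- A global configuration of a ring of `n` processes. -/
structure Config (A : Algorithm) (n : ℕ) where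
  /-- the local state of each process -/
  state : Fin n → A.State
  /-- `pending i p` is the number of messages sent towards port `p` of process `i` and not yet
  received by it: those still travelling and those waiting in its local buffer. -/
  pending : Fin n → Port → ℕ
  /-- `sent i p` counts the messages that process `i` has sent on port `p` so far. -/
  sent : Fin n → Port → ℕ

namespace Algorithm

variable (A : Algorithm) {n : ℕ}

/-- The initial configuration: no message has been sent. -/
def initial (U : ℕ) (ids : Fin n → ℕ) : Config A n where
  state i := A.init U (ids i)
  pending _ _ := 0
  sent _ _ := 0

/-- `A.Step i c c'`: process `i` performs one action, which changes `c` into `c'`. A message sent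
on port `p` of `i` arrives at the opposite port of the neighbour. If a process that is willing to
receive on both ports has messages pending on both, either of them may be received. -/
inductive Step [NeZero n] (i : Fin n) (c : Config A n) : Config A n → Prop where
  | send (p : Port) (s : A.State) (h : A.action (c.state i) = .send p s) :
      Step i c
        { state := Function.update c.state i s
          pending := fun j q =>
            if j = neighbor i p ∧ q = p.other then c.pending j q + 1 else c.pending j q
          sent := fun j q => if j = i ∧ q = p then c.sent j q + 1 else c.sent j q }
  | receive (next : Port → Option A.State) (h : A.action (c.state i) = .receive next)
      (p : Port) (s : A.State) (hs : next p = some s) (hp : 0 < c.pending i p) :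
      Step i c
        { state := Function.update c.state i s
          pending := fun j q => if j = i ∧ q = p then c.pending j q - 1 else c.pending j q
          sent := c.sent }

/-- An asynchronous execution. At each time one process performs an action or nothing happens. The
adversary chooses the interleaving and all delays, but delays are finite: a process that can act
(it is about to send, or it waits on a port for which a message is pending) is not delayed
forever. -/
structure IsExecution [NeZero n] (U : ℕ) (ids : Fin n → ℕ) (e : ℕ → Config A n) : Prop where
  start : e 0 = A.initial U ids
  next : ∀ t, e (t + 1) = e t ∨ ∃ i, A.Step i (e t) (e (t + 1))
  fair : ∀ i t, ∃ t', t ≤ t' ∧ ((¬ ∃ c, A.Step i (e t') c) ∨ A.Step i (e t') (e (t' + 1)))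

variable {A}

/-- Process `i` is in the final state with outcome `o`. -/
def HasOutput (c : Config A n) (i : Fin n) (o : Output) : Prop :=
  A.action (c.state i) = .halt o

/-- Every process is in a final state. -/
def AllFinal (c : Config A n) : Prop :=
  ∀ i, ∃ o, HasOutput c i o

/-- No message is in transit (or waiting in a buffer). -/
def Quiescent (c : Config A n) : Prop :=
  ∀ i p, c.pending i p = 0

/-- The number of clockwise messages sent by process `i`. -/
def cwSent (c : Config A n) (i : Fin n) : ℕ := c.sent i .zero

/-- The number of counter-clockwise messages sent by process `i`. -/
def ccwSent (c : Config A n) (i : Fin n) : ℕ := c.sent i .one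

/-- The number of all messages sent. -/
def totalSent (c : Config A n) : ℕ := ∑ i, (cwSent c i + ccwSent c i)

variable (A)

/-- `A` is a quiescently terminating non-uniform leader election algorithm for oriented rings: on
every ring of `n ≥ 1` processes with distinct identifiers that know a bound `U ≥ n`, in every
execution, all processes eventually are in a final state, and once they are, exactly one of them is
the leader, all others are non-leaders, and there are no messages in transit. -/
def IsQuiescentLeaderElection : Prop :=
  ∀ (n : ℕ) [NeZero n] (U : ℕ) (ids : Fin n → ℕ), n ≤ U → Function.Injective ids →
    ∀ e : ℕ → Config A n, A.IsExecution U ids e →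
      (∃ t, AllFinal (e t)) ∧
      ∀ t, AllFinal (e t) →
        (∃ l, HasOutput (e t) l .leader ∧ ∀ i, i ≠ l → HasOutput (e t) i .nonLeader) ∧
        Quiescent (e t)

end Algorithm

/-- The smallest identifier on the ring. -/
def minId {n : ℕ} [NeZero n] (ids : Fin n → ℕ) : ℕ :=
  Finset.univ.inf' Finset.univ_nonempty ids

/-! The algorithm `ElectionWithOneDirectionConstant(ID, U)`:

```
for i = 1 to U * ID:
    send on port 0
    receive on port q
    if q = 0: break
if q = 0:                            (some message was received on port 0)
    send on port 1
    receive on port 1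
    repeat
        receive on port q
        send on port 1 - q
    until two messages have been received on port 0 in this loop
    return Non-Leader
else:
    send on port 1
    receive on port 0
    send on port 1
    repeat
        receive on port q
        if q = 1: send on port 0
    until q = 0
    send on port 1
    receive on port 0
    return Leader
```
-/

namespace OneDirectionConstant

/-- Program points of the algorithm, with the values of the local counters. -/
inductive State where
  /-- competing loop, about to send, with `k` iterations to come after the present one -/
  | competeSend (k : ℕ)
  /-- competing loop, about to receive, with `k` iterations to come after the present one -/
  | competeReceive (k : ℕ)
  /-- left the competing loop by `break`: first send on port 1 -/
  | relayStart
  /-- receive, and do not forward, one message on port 1 -/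
  | relayAbsorb
  /-- relay loop, about to receive; `c` messages were received on port 0 in this loop -/
  | relayReceive (c : ℕ)
  /-- relay loop, about to send on port `1 - q`; `c` messages were received on port 0 -/
  | relaySend (q : Port) (c : ℕ)
  /-- returned `Non-Leader` -/
  | nonLeader
  /-- completed the competing loop: first send on port 1 -/
  | winSend₁
  /-- first receive on port 0 -/
  | winReceive₁
  /-- second send on port 1 -/
  | winSend₂
  /-- loop until a message is received on port 0 -/
  | winLoop
  /-- in that loop, a message was received on port 1: send on port 0 -/
  | winForward
  /-- third send on port 1 -/
  | winSend₃
  /-- last receive on port 0 -/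
  | winReceive₃
  /-- returned `Leader` -/
  | leader

/-- Test of the competing loop, with `k` iterations left. -/
def State.compete : ℕ → State
  | 0 => .winSend₁
  | k + 1 => .competeSend k

/-- The action at each program point. -/
def action : State → Action State
  | .competeSend k => .send .zero (.competeReceive k)
  | .competeReceive k => .receiveAny fun
      | .zero => .relayStart
      | .one => .compete k
  | .relayStart => .send .one .relayAbsorb
  | .relayAbsorb => .receiveOn .one (.relayReceive 0)
  | .relayReceive c => .receiveAny fun
      | .zero => .relaySend .zero (c + 1)
      | .one => .relaySend .one c
  | .relaySend q c => .send q.other (if c = 2 then .nonLeader else .relayReceive c)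
  | .nonLeader => .halt .nonLeader
  | .winSend₁ => .send .one .winReceive₁
  | .winReceive₁ => .receiveOn .zero .winSend₂
  | .winSend₂ => .send .one .winLoop
  | .winLoop => .receiveAny fun
      | .zero => .winSend₃
      | .one => .winForward
  | .winForward => .send .zero .winLoop
  | .winSend₃ => .send .one .winReceive₃
  | .winReceive₃ => .receiveOn .zero .leader
  | .leader => .halt .leader

end OneDirectionConstant

/-- The algorithm `ElectionWithOneDirectionConstant`. -/
def electionWithOneDirectionConstant : Algorithm where
  State := OneDirectionConstant.State
  init U ID := .compete (U * ID)
  action := OneDirectionConstant.action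

end ContentOblivious

open ContentOblivious ContentOblivious.Algorithm

/-!
The execution is controlled by an invariant that reads almost everything off the program points of
the processes. At each program point, the number of counter-clockwise messages sent and received
(`State.ccwOut`, `State.ccwIn`) and the difference between clockwise messages sent and received
(`State.cwSurplus`, one of `-1`, `0`, `1`) are determined, and on each link the messages sent are
those received plus those pending.

*Leader.* Since the surplus is at most `1`, the clockwise counts of neighbours satisfy
`sent (i + 1) ≤ sent i + 1`, so any two processes differ by less than `n`
(`Invariant.cwSent_lt`). Let `m` have the smallest identifier and put `T = U * ID_min`. A process
that is not a winner sends a counter-clockwise message only after receiving one, so `m` sends the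
first one and is never expelled from its competing loop. While some process still competes, `m` has
sent at most `T` clockwise messages, so every process has sent fewer than `T + n`, which is less
than the `U * ID ≥ T + U` rounds that any other process would have to complete. Hence only `m` can
win (`Invariant.step`).

*Message bounds.* The surpluses add up to the number of pending clockwise messages, which is
nonnegative. So whenever a relay or the winner forwards a clockwise message, some process still has
surplus `1`; it has not sent clockwise messages since it competed, so its count is below `T + n`,
and all counts stay at most `T + 2 * n` (`Invariant.cwSent_lt_of_send_zero`). Counter-clockwise
counts never exceed that of `m`, which is at most `3`.

*Termination.* The total number of actions is therefore bounded, and by fairness a configuration is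
reached in which nobody can act (`exists_stuck`). A counter-clockwise message that `m` waits for
cannot be blocked forever: it could only be held up at relays waiting to absorb a clockwise message,
but when `m` and all others listen for clockwise messages none can be pending, which forces every
surplus to be `0`, so that no relay waits. Thus a stuck configuration is final
(`Invariant.allFinal_of_stuck`), and there the flow equations show that nothing is pending.
-/

namespace ContentOblivious

/-! ### Local bookkeeping -/

namespace OneDirectionConstant

/-- The number of clockwise messages sent minus the number of clockwise messages received by a
process that has reached the given program point. -/
def State.cwSurplus : State → ℤ
  | .competeReceive _ | .relayStart | .relayAbsorb => 1
  | .relaySend .one _ | .winForward => -1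
  | _ => 0

/-- The number of counter-clockwise messages sent by a process that has reached the given program
point. -/
def State.ccwOut : State → ℕ
  | .competeSend _ | .competeReceive _ | .relayStart | .winSend₁ => 0
  | .relayAbsorb | .winReceive₁ | .winSend₂ => 1
  | .relayReceive c | .relaySend .one c => c + 1
  | .relaySend .zero c => c
  | .winLoop | .winForward | .winSend₃ => 2
  | .winReceive₃ | .nonLeader | .leader => 3

/-- The number of counter-clockwise messages received by a process that has reached the given
program point. -/
def State.ccwIn : State → ℕ
  | .competeSend _ | .competeReceive _ | .winSend₁ | .winReceive₁ => 0
  | .relayStart | .relayAbsorb | .winSend₂ | .winLoop | .winForward => 1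
  | .relayReceive c | .relaySend _ c => c + 1
  | .winSend₃ | .winReceive₃ => 2
  | .nonLeader | .leader => 3

/-- The program points of a process that has completed the competing loop. -/
def State.IsWinner : State → Prop
  | .winSend₁ | .winReceive₁ | .winSend₂ | .winLoop | .winForward | .winSend₃ | .winReceive₃
  | .leader => True
  | _ => False

/-- The program points of a process that has left the competing loop by `break`. -/
def State.IsRelay : State → Prop
  | .relayStart | .relayAbsorb | .relayReceive _ | .relaySend _ _ | .nonLeader => True
  | _ => False

/-- What a program point says about the number `s` of clockwise messages sent so far and about the
local counters, for a process whose competing loop has `N` iterations. -/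
def State.CounterOk (N s : ℕ) : State → Prop
  | .competeSend k => s + k + 1 = N
  | .competeReceive k => s + k = N
  | .winSend₁ | .winReceive₁ | .winSend₂ => s = N
  | .relayReceive c => c ≠ 2
  | _ => True

/-- The program points of a relay that has not yet absorbed its clockwise message. -/
def State.AwaitsAbsorb : State → Prop
  | .relayStart | .relayAbsorb => True
  | _ => False

/-- `SendStep st p s`: in state `st` the algorithm sends on port `p` and continues in `s`. -/
inductive SendStep : State → Port → State → Prop
  | compete (k) : SendStep (.competeSend k) .zero (.competeReceive k)
  | relayStart : SendStep .relayStart .one .relayAbsorb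
  | relayZero (c) (h : c ≠ 2) : SendStep (.relaySend .zero c) .one (.relayReceive c)
  | relayZeroLast : SendStep (.relaySend .zero 2) .one .nonLeader
  | relayOne (c) (h : c ≠ 2) : SendStep (.relaySend .one c) .zero (.relayReceive c)
  | relayOneLast : SendStep (.relaySend .one 2) .zero .nonLeader
  | win₁ : SendStep .winSend₁ .one .winReceive₁
  | win₂ : SendStep .winSend₂ .one .winLoop
  | winForward : SendStep .winForward .zero .winLoop
  | win₃ : SendStep .winSend₃ .one .winReceive₃

/-- `ReceiveStep st p s`: in state `st` the algorithm accepts a message on port `p` and then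
continues in `s`. -/
inductive ReceiveStep : State → Port → State → Prop
  | breakLoop (k) : ReceiveStep (.competeReceive k) .zero .relayStart
  | completeLoop : ReceiveStep (.competeReceive 0) .one .winSend₁
  | nextRound (k) : ReceiveStep (.competeReceive (k + 1)) .one (.competeSend k)
  | relayAbsorb : ReceiveStep .relayAbsorb .one (.relayReceive 0)
  | relayZero (c) : ReceiveStep (.relayReceive c) .zero (.relaySend .zero (c + 1))
  | relayOne (c) : ReceiveStep (.relayReceive c) .one (.relaySend .one c)
  | win₁ : ReceiveStep .winReceive₁ .zero .winSend₂
  | winLoop : ReceiveStep .winLoop .zero .winSend₃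
  | winForward : ReceiveStep .winLoop .one .winForward
  | win₃ : ReceiveStep .winReceive₃ .zero .leader

theorem sendStep_of_action {st s : State} {p : Port} (h : action st = .send p s) :
    SendStep st p s := by
  cases st with
  | relaySend q c =>
    by_cases hc : c = 2
    · subst hc
      cases q <;> simp only [action, Port.other, if_true, Action.send.injEq] at h <;>
        obtain ⟨rfl, rfl⟩ := h <;> constructor
    · cases q <;> simp only [action, Port.other, if_neg hc, Action.send.injEq] at h <;>
        obtain ⟨rfl, rfl⟩ := h <;> constructor <;> exact hc
  | _ =>
    simp only [action, Action.receiveAny, Action.receiveOn, Action.send.injEq, reduceCtorEq] at h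
    try (obtain ⟨rfl, rfl⟩ := h; constructor)

theorem receiveStep_of_action {st s : State} {next : Port → Option State} {p : Port}
    (h : action st = .receive next) (hs : next p = some s) : ReceiveStep st p s := by
  cases st <;>
    simp only [action, Action.receiveAny, Action.receiveOn, Action.receive.injEq,
      reduceCtorEq] at h <;>
    subst h <;> cases p <;> simp at hs <;> subst hs <;> try constructor
  rename_i k
  cases k <;> constructor

namespace SendStep

variable {st s : State} {p : Port}

theorem cwSurplus (h : SendStep st p s) :
    s.cwSurplus = st.cwSurplus + (if p = .zero then 1 else 0) := by
  cases h <;> simp [State.cwSurplus]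

theorem ccwOut (h : SendStep st p s) : s.ccwOut = st.ccwOut + (if p = .one then 1 else 0) := by
  cases h <;> simp [State.ccwOut]

theorem ccwIn (h : SendStep st p s) : s.ccwIn = st.ccwIn := by
  cases h <;> simp [State.ccwIn]

theorem isWinner (h : SendStep st p s) (hs : s.IsWinner) : st.IsWinner := by
  cases h <;> exact hs

theorem isRelay (h : SendStep st p s) (hs : s.IsRelay) : st.IsRelay := by
  cases h <;> exact hs

theorem counterOk {N k : ℕ} (h : SendStep st p s) (hk : st.CounterOk N k) :
    s.CounterOk N (if p = .zero then k + 1 else k) := by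
  cases h <;> simp_all [State.CounterOk]
  omega

theorem awaitsAbsorb (h : SendStep st p s) (hs : s.AwaitsAbsorb) : p = .one ∧ st.AwaitsAbsorb := by
  cases h <;> simp_all [State.AwaitsAbsorb]

theorem zero_cases (h : SendStep st .zero s) :
    (∃ k, st = .competeSend k) ∨ st.cwSurplus = -1 := by
  cases h <;> simp [State.cwSurplus]

end SendStep

namespace ReceiveStep

variable {st s : State} {p : Port}

theorem cwSurplus (h : ReceiveStep st p s) :
    s.cwSurplus = st.cwSurplus - (if p = .one then 1 else 0) := by
  cases h <;> simp [State.cwSurplus]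

theorem ccwOut (h : ReceiveStep st p s) : s.ccwOut = st.ccwOut := by
  cases h <;> simp [State.ccwOut]

theorem ccwIn (h : ReceiveStep st p s) : s.ccwIn = st.ccwIn + (if p = .zero then 1 else 0) := by
  cases h <;> simp [State.ccwIn]

theorem isWinner (h : ReceiveStep st p s) (hs : s.IsWinner) :
    st.IsWinner ∨ st = .competeReceive 0 := by
  cases h <;> simp_all [State.IsWinner]

theorem isRelay (h : ReceiveStep st p s) (hs : s.IsRelay) :
    st.IsRelay ∨ st.ccwOut = 0 ∧ st.ccwIn = 0 ∧ p = .zero := by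
  cases h <;> simp_all [State.IsRelay, State.ccwOut, State.ccwIn]

theorem counterOk {N k : ℕ} (h : ReceiveStep st p s) (hk : st.CounterOk N k) :
    s.CounterOk N k := by
  cases h <;> simp_all [State.CounterOk]
  omega

theorem awaitsAbsorb (h : ReceiveStep st p s) (hs : s.AwaitsAbsorb) :
    ∃ k, st = .competeReceive k := by
  cases h <;> simp_all [State.AwaitsAbsorb]

end ReceiveStep

theorem cwSurplus_le_one (st : State) : st.cwSurplus ≤ 1 := by
  unfold State.cwSurplus
  split <;> simp

theorem neg_one_le_cwSurplus (st : State) : -1 ≤ st.cwSurplus := by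
  unfold State.cwSurplus
  split <;> simp

theorem cwSurplus_eq_one {st : State} (h : st.cwSurplus = 1) :
    (∃ k, st = .competeReceive k) ∨ st.AwaitsAbsorb := by
  unfold State.cwSurplus at h
  split at h <;> simp_all [State.AwaitsAbsorb]

theorem ccwOut_le_ccwIn {st : State} (h : ¬ st.IsWinner) : st.ccwOut ≤ st.ccwIn := by
  unfold State.ccwOut
  split <;> simp_all [State.ccwIn, State.IsWinner]

theorem ccwOut_le_three {st : State} (h : ¬ st.IsRelay) : st.ccwOut ≤ 3 := by
  unfold State.ccwOut
  split <;> simp_all [State.IsRelay]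

theorem cwSent_le_of_ccwIn_eq_zero {st : State} {N s : ℕ} (hc : st.CounterOk N s)
    (h : st.ccwIn = 0) : s ≤ N := by
  unfold State.CounterOk at hc
  split at hc <;> simp_all [State.ccwIn] <;> first | omega | cases st <;> simp_all

theorem cases_of_not_isWinner {st : State} {N k : ℕ} (hs : ∀ p s, action st ≠ .send p s)
    (hw : ¬ st.IsWinner) (hc : st.CounterOk N k) :
    (∃ k, st = .competeReceive k) ∨ st = .relayAbsorb ∨
      (∃ k, st = .relayReceive k ∧ k ≠ 2) ∨ st = .nonLeader := by
  cases st <;> simp_all [action, State.IsWinner, State.CounterOk]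

theorem cases_of_not_isRelay {st : State} (hs : ∀ p s, action st ≠ .send p s)
    (hr : ¬ st.IsRelay) :
    (∃ k, st = .competeReceive k) ∨ st = .winReceive₁ ∨ st = .winLoop ∨ st = .winReceive₃ ∨
      st = .leader := by
  cases st <;> simp_all [action, State.IsRelay]

theorem eq_leader_of_action_halt {st : State} {o : Output} (h : action st = .halt o)
    (hr : ¬ st.IsRelay) : st = .leader := by
  cases st <;> simp_all [action, Action.receiveAny, Action.receiveOn, State.IsRelay]

theorem eq_nonLeader_of_action_halt {st : State} {o : Output} (h : action st = .halt o)
    (hw : ¬ st.IsWinner) : st = .nonLeader := by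
  cases st <;> simp_all [action, Action.receiveAny, Action.receiveOn, State.IsWinner]

theorem compete_cases (N : ℕ) :
    State.compete N = .winSend₁ ∧ N = 0 ∨ ∃ k, State.compete N = .competeSend k ∧ N = k + 1 := by
  cases N <;> simp [State.compete]

end OneDirectionConstant

/-! ### Inequalities around the ring -/

section Ring

variable {n : ℕ} [NeZero n]

theorem val_nsmul_one (k : ℕ) : (k • (1 : Fin n)).val = k % n := by
  induction k with
  | zero => simp
  | succ k ih => rw [succ_nsmul, Fin.val_add, ih, Fin.val_one', ← Nat.add_mod]

theorem add_val_nsmul_one (i j : Fin n) : j + (i - j).val • (1 : Fin n) = i := by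
  have : (i - j).val • (1 : Fin n) = i - j := by
    apply Fin.ext
    rw [val_nsmul_one, Nat.mod_eq_of_lt (i - j).isLt]
  rw [this, add_sub_cancel]

/-- Induction along the ring, starting behind `m` and never passing through `m`. -/
theorem forall_of_succ {P : Fin n → Prop} (m : Fin n) (h0 : P (m + 1))
    (hs : ∀ i, i ≠ m → P i → P (i + 1)) (i : Fin n) : P i := by
  have key : ∀ k : ℕ, P (m + 1 + k • 1) := by
    intro k
    induction k with
    | zero => simpa using h0
    | succ k ih =>
      by_cases h : m + 1 + k • 1 = m
      · rw [succ_nsmul, ← add_assoc, h]; exact h0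
      · rw [succ_nsmul, ← add_assoc]; exact hs _ h ih
  rw [← add_val_nsmul_one i (m + 1)]
  exact key _

/-- Induction against the direction of the ring, from `m` on. -/
theorem forall_of_pred {P : Fin n → Prop} (m : Fin n) (h0 : P m)
    (hs : ∀ i, i ≠ m → P (i + 1) → P i) (i : Fin n) : P i := by
  by_contra hi
  have key : ∀ k : ℕ, ¬ P (i + k • 1) := by
    intro k
    induction k with
    | zero => simpa using hi
    | succ k ih =>
      rw [succ_nsmul, ← add_assoc]
      exact fun h => ih (hs _ (fun hm => ih (hm ▸ h0)) h)
  refine key (m - i).val ?_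
  rwa [add_val_nsmul_one]

theorem lt_add_of_succ_le {f : Fin n → ℕ} (hf : ∀ i, f (i + 1) ≤ f i + 1) (i j : Fin n) :
    f i < f j + n := by
  have key : ∀ k : ℕ, f (j + k • 1) ≤ f j + k := by
    intro k
    induction k with
    | zero => simp
    | succ k ih => rw [succ_nsmul, ← add_assoc]; have := hf (j + k • 1); omega
  have := key (i - j).val
  rw [add_val_nsmul_one] at this
  have := (i - j).isLt
  omega

end Ring

/-! ### The invariant -/

open OneDirectionConstant Algorithm

local notation "EA" => electionWithOneDirectionConstant

/-- The invariant of all executions; `m` is the process with the smallest identifier and `T` is the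
number of iterations of its competing loop. The fields `cw_flow` and `ccw_flow` express, for the
link between `i` and `i + 1`, that no message is lost or created: the number of messages received
at one end is expressed through the program point there. The bounds `awaits` and `bound` hold for
different reasons: a relay that awaits its absorbed message has sent no clockwise message since
it competed, and its count limits those of all other processes. -/
structure Invariant {n : ℕ} [NeZero n] (U : ℕ) (ids : Fin n → ℕ) (m : Fin n) (T : ℕ)
    (c : Config EA n) : Prop where
  cw_flow : ∀ i, (c.sent (i + 1) .zero : ℤ) + c.pending (i + 1) .one =
    c.sent i .zero + State.cwSurplus (c.state (i + 1))
  ccw_flow : ∀ i, c.pending i .zero + State.ccwIn (c.state i) = State.ccwOut (c.state (i + 1))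
  ccw_sent : ∀ i, c.sent i .one = State.ccwOut (c.state i)
  not_winner : ∀ i, i ≠ m → ¬ State.IsWinner (c.state i)
  not_relay : ¬ State.IsRelay (c.state m)
  counter : ∀ i, State.CounterOk (U * ids i) (c.sent i .zero) (c.state i)
  awaits : ∀ i, State.AwaitsAbsorb (c.state i) → c.sent i .zero < T + n
  bound : ∀ i, c.sent i .zero ≤ T + 2 * n

namespace Invariant

variable {n : ℕ} [NeZero n] {U : ℕ} {ids : Fin n → ℕ} {m : Fin n} {T : ℕ} {c : Config EA n}

theorem cwSent_lt (h : Invariant U ids m T c) (i j : Fin n) :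
    c.sent i .zero < c.sent j .zero + n := by
  refine lt_add_of_succ_le (f := fun i => c.sent i .zero) (fun i => ?_) i j
  have h1 := h.cw_flow i
  have h2 := cwSurplus_le_one (c.state (i + 1))
  omega

theorem ccwOut_le (h : Invariant U ids m T c) (i : Fin n) :
    State.ccwOut (c.state i) ≤ State.ccwOut (c.state m) := by
  refine forall_of_pred (P := fun i => State.ccwOut (c.state i) ≤ State.ccwOut (c.state m)) m
    le_rfl (fun i hi hs => ?_) i
  have h1 := h.ccw_flow i
  have h2 := ccwOut_le_ccwIn (h.not_winner i hi)
  omega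

theorem ccwIn_le (h : Invariant U ids m T c) (i : Fin n) :
    State.ccwIn (c.state m) ≤ State.ccwOut (c.state i) := by
  refine forall_of_succ (P := fun i => State.ccwIn (c.state m) ≤ State.ccwOut (c.state i)) m
    ?_ (fun i hi hs => ?_) i
  · have := h.ccw_flow m
    omega
  · have h1 := h.ccw_flow i
    have h2 := ccwOut_le_ccwIn (h.not_winner i hi)
    omega

/-- While some process has not sent its first counter-clockwise message, the minimal process has
not received one, and so it has sent at most `T` clockwise messages. -/
theorem cwSent_lt_of_ccwOut_eq_zero (h : Invariant U ids m T c) (hT : T = U * ids m) {i : Fin n}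
    (hi : State.ccwOut (c.state i) = 0) (j : Fin n) : c.sent j .zero < T + n := by
  have h1 := h.ccwIn_le i
  have h2 := cwSent_le_of_ccwIn_eq_zero (h.counter m) (by omega)
  have h3 := h.cwSent_lt j m
  omega

theorem sum_pending (h : Invariant U ids m T c) :
    ∑ i, (c.pending i .one : ℤ) = ∑ i, State.cwSurplus (c.state i) := by
  have h1 : ∀ f : Fin n → ℤ, ∑ i, f (i + 1) = ∑ i, f i :=
    fun f => Equiv.sum_comp (Equiv.addRight (1 : Fin n)) f
  have h2 := Finset.sum_congr (rfl : (Finset.univ : Finset (Fin n)) = _) fun i _ => h.cw_flow i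
  rw [Finset.sum_add_distrib, Finset.sum_add_distrib,
    h1 fun i => (c.sent i .zero : ℤ), h1 fun i => (c.pending i .one : ℤ),
    h1 fun i => State.cwSurplus (c.state i)] at h2
  linarith

/-- A process with a negative surplus is compensated by one with a positive surplus, and such a
process has sent fewer than `T + n` clockwise messages. -/
theorem cwSent_lt_of_send_zero (h : Invariant U ids m T c) (hT : T = U * ids m) {i : Fin n}
    {s : State} (hs : SendStep (c.state i) .zero s) : c.sent i .zero < T + 2 * n := by
  rcases hs.zero_cases with ⟨k, hk⟩ | hneg
  · have := h.cwSent_lt_of_ccwOut_eq_zero hT (i := i) (by rw [hk]; rfl) i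
    omega
  · obtain ⟨j, hj⟩ : ∃ j, State.cwSurplus (c.state j) = 1 := by
      by_contra! hne
      have hle : ∀ j, State.cwSurplus (c.state j) ≤ 0 := fun j => by
        have := cwSurplus_le_one (c.state j)
        have := hne j
        omega
      have h1 : ∑ j, State.cwSurplus (c.state j) < 0 :=
        Finset.sum_neg' (fun j _ => hle j) ⟨i, Finset.mem_univ i, by omega⟩
      have h2 : (0 : ℤ) ≤ ∑ j, (c.pending j .one : ℤ) := Finset.sum_nonneg fun j _ => by positivity
      rw [h.sum_pending] at h2
      omega
    have h3 := h.cwSent_lt i j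
    rcases cwSurplus_eq_one hj with ⟨k, hk⟩ | haw
    · have := h.cwSent_lt_of_ccwOut_eq_zero hT (i := j) (by rw [hk]; rfl) j
      omega
    · have := h.awaits j haw
      omega

theorem initial (hn : n ≤ U) (hT : T = U * ids m) (hm : ∀ i, i ≠ m → ids m < ids i) :
    Invariant U ids m T (Algorithm.initial EA U ids) := by
  have hU : 0 < U := (Nat.pos_of_ne_zero (NeZero.ne n)).trans_le hn
  constructor <;> intros <;>
    simp only [Algorithm.initial, electionWithOneDirectionConstant, Nat.cast_zero, zero_add,
      Nat.zero_le] at *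
  · rename_i i
    rcases compete_cases (U * ids (i + 1)) with ⟨h, -⟩ | ⟨k, h, -⟩ <;> rw [h] <;> rfl
  · rename_i i
    rcases compete_cases (U * ids (i + 1)) with ⟨h, -⟩ | ⟨k, h, -⟩ <;>
      rcases compete_cases (U * ids i) with ⟨h', -⟩ | ⟨k', h', -⟩ <;> rw [h, h'] <;> rfl
  · rename_i i
    rcases compete_cases (U * ids i) with ⟨h, -⟩ | ⟨k, h, -⟩ <;> rw [h] <;> rfl
  · rename_i i hi
    rcases compete_cases (U * ids i) with ⟨-, h⟩ | ⟨k, h, -⟩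
    · have := hm i hi
      rcases mul_eq_zero.1 h with h | h <;> omega
    · rw [h]; exact id
  · rcases compete_cases (U * ids m) with ⟨h, -⟩ | ⟨k, h, -⟩ <;> rw [h] <;> exact id
  · rename_i i
    rcases compete_cases (U * ids i) with ⟨h, h'⟩ | ⟨k, h, h'⟩ <;> rw [h] <;>
      simp [State.CounterOk, h']
  · have := Nat.pos_of_ne_zero (NeZero.ne n)
    omega

theorem step (h : Invariant U ids m T c) (hn : n ≤ U) (hT : T = U * ids m)
    (hm : ∀ i, i ≠ m → ids m < ids i) {i : Fin n} {c' : Config EA n} (hstep : Step EA i c c') :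
    Invariant U ids m T c' := by
  cases hstep with
  | send p s hact =>
    have hs : SendStep (c.state i) p s := sendStep_of_action hact
    have hsur : ∀ j, State.cwSurplus (Function.update c.state i s j) =
        State.cwSurplus (c.state j) + if j = i ∧ p = .zero then 1 else 0 := fun j => by
      by_cases hj : j = i
      · subst hj; simpa using hs.cwSurplus
      · simp [hj]
    have hin : ∀ j, State.ccwIn (Function.update c.state i s j) = State.ccwIn (c.state j) :=
      fun j => by
        by_cases hj : j = i
        · subst hj; simpa using hs.ccwIn
        · simp [hj]
    have hout : ∀ j, State.ccwOut (Function.update c.state i s j) =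
        State.ccwOut (c.state j) + if j = i ∧ p = .one then 1 else 0 := fun j => by
      by_cases hj : j = i
      · subst hj; simpa using hs.ccwOut
      · simp [hj]
    constructor
    · intro j
      have h0 := h.cw_flow j
      have h1 := hsur (j + 1)
      cases p <;> simp only [neighbor, Port.other, add_left_inj, reduceCtorEq, and_true, and_false,
        if_false] at h1 ⊢ <;> (try split_ifs at h1 ⊢) <;> omega
    · intro j
      have h0 := h.ccw_flow j
      have h1 := hin j
      have h2 := hout (j + 1)
      cases p <;> simp only [neighbor, Port.other, eq_sub_iff_add_eq, reduceCtorEq, and_true,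
        and_false, if_false] at h2 ⊢ <;> (try split_ifs at h2 ⊢) <;> omega
    · intro j
      have h0 := h.ccw_sent j
      have h1 := hout j
      simp only [eq_comm (a := Port.one)]
      split_ifs at h1 ⊢ <;> omega
    · intro j hj
      have h0 := h.not_winner j hj
      by_cases h3 : j = i
      · subst h3
        simpa using fun hw => h0 (hs.isWinner hw)
      · simpa [Function.update_apply, h3] using h0
    · have h0 := h.not_relay
      by_cases h3 : m = i
      · subst h3
        simpa using fun hw => h0 (hs.isRelay hw)
      · simpa [Function.update_apply, h3] using h0
    · intro j
      have h0 := h.counter j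
      by_cases h3 : j = i
      · subst h3
        have := hs.counterOk h0
        cases p <;> simpa using this
      · simpa [Function.update_apply, h3] using h0
    · intro j
      have h0 := h.awaits j
      by_cases h3 : j = i
      · subst h3
        intro hw
        obtain ⟨rfl, h5⟩ := hs.awaitsAbsorb (by simpa using hw)
        simpa using h0 h5
      · simpa [Function.update_apply, h3] using h0
    · intro j
      have h0 := h.bound j
      dsimp only
      split_ifs with h3
      · obtain ⟨rfl, rfl⟩ := h3
        exact h.cwSent_lt_of_send_zero hT hs
      · exact h0
  | receive next hact p s hs' hp =>
    have hs : ReceiveStep (c.state i) p s := receiveStep_of_action hact hs'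
    have hsur : ∀ j, State.cwSurplus (Function.update c.state i s j) =
        State.cwSurplus (c.state j) - if j = i ∧ p = .one then 1 else 0 := fun j => by
      by_cases hj : j = i
      · subst hj; simpa using hs.cwSurplus
      · simp [hj]
    have hin : ∀ j, State.ccwIn (Function.update c.state i s j) =
        State.ccwIn (c.state j) + if j = i ∧ p = .zero then 1 else 0 := fun j => by
      by_cases hj : j = i
      · subst hj; simpa using hs.ccwIn
      · simp [hj]
    have hout : ∀ j, State.ccwOut (Function.update c.state i s j) = State.ccwOut (c.state j) :=
      fun j => by
        by_cases hj : j = i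
        · subst hj; simpa using hs.ccwOut
        · simp [hj]
    constructor
    · intro j
      have h0 := h.cw_flow j
      have h1 := hsur (j + 1)
      simp only [eq_comm (a := Port.one)]
      split_ifs at h1 ⊢ with h2
      · obtain ⟨rfl, rfl⟩ := h2
        omega
      · omega
    · intro j
      have h0 := h.ccw_flow j
      have h1 := hin j
      have h2 := hout (j + 1)
      simp only [eq_comm (a := Port.zero)]
      split_ifs at h1 ⊢ with h3
      · obtain ⟨rfl, rfl⟩ := h3
        omega
      · omega
    · intro j
      exact (h.ccw_sent j).trans (hout j).symm
    · intro j hj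
      have h0 := h.not_winner j hj
      by_cases h3 : j = i
      · subst h3
        intro hw
        rcases hs.isWinner (by simpa using hw) with h5 | h5
        · exact h0 h5
        -- `j` would have sent `U * ids j ≥ T + U ≥ T + n` clockwise messages.
        · have h6 := h.cwSent_lt_of_ccwOut_eq_zero hT (i := j) (by rw [h5]; rfl) j
          have h7 := h.counter j
          rw [h5] at h7
          have h8 : c.sent j .zero + 0 = U * ids j := h7
          have h9 := Nat.mul_le_mul_left U (Nat.succ_le_of_lt (hm j hj))
          rw [Nat.mul_succ] at h9
          omega
      · simpa [Function.update_apply, h3] using h0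
    · have h0 := h.not_relay
      by_cases h3 : m = i
      · subst h3
        intro hw
        rcases hs.isRelay (by simpa using hw) with h5 | ⟨h5, h6, rfl⟩
        · exact h0 h5
        -- The first counter-clockwise message on the ring is sent by `m` itself.
        · have h7 := h.ccw_flow m
          have h8 := h.ccwOut_le (m + 1)
          omega
      · simpa [Function.update_apply, h3] using h0
    · intro j
      have h0 := h.counter j
      by_cases h3 : j = i
      · subst h3
        simpa using hs.counterOk h0
      · simpa [Function.update_apply, h3] using h0
    · intro j
      have h0 := h.awaits j
      by_cases h3 : j = i
      · subst h3
        intro hw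
        obtain ⟨k, h5⟩ := hs.awaitsAbsorb (by simpa using hw)
        exact h.cwSent_lt_of_ccwOut_eq_zero hT (i := j) (by rw [h5]; rfl) j
      · simpa [Function.update_apply, h3] using h0
    · exact h.bound

/-! ### Deadlock freedom and quiescence -/

theorem all_pending_one_eq_zero (h : Invariant U ids m T c)
    (hs : ∀ i, State.cwSurplus (c.state i) ≤ 0) (i : Fin n) : c.pending i .one = 0 := by
  have h1 := h.sum_pending
  have h2 : ∑ i, State.cwSurplus (c.state i) ≤ 0 := Finset.sum_nonpos fun i _ => hs i
  have h3 : (c.pending i .one : ℤ) ≤ ∑ i, (c.pending i .one : ℤ) :=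
    Finset.single_le_sum (f := fun i => (c.pending i .one : ℤ)) (fun j _ => by positivity)
      (Finset.mem_univ i)
  omega

/-- The contradiction behind deadlock freedom: `m` waits for its next counter-clockwise message
after receiving `a` of them. If every other process that has sent `a` of them has also received
exactly `a` and has none pending, then going once around the ring shows that `m` itself has sent
only `a`. -/
theorem ccwOut_eq_of_forall (h : Invariant U ids m T c) {a : ℕ}
    (ha : State.ccwIn (c.state m) = a) (hm0 : c.pending m .zero = 0)
    (hp : ∀ i, i ≠ m → State.ccwOut (c.state i) = a →
      c.pending i .zero = 0 ∧ State.ccwIn (c.state i) = a) :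
    State.ccwOut (c.state m) = a := by
  refine forall_of_succ (P := fun i => State.ccwOut (c.state i) = a) m ?_ (fun i hi hs => ?_) m
  · have := h.ccw_flow m
    omega
  · have h1 := h.ccw_flow i
    have h2 := hp i hi hs
    omega

/-- A configuration in which no process can act has reached the end of the algorithm: otherwise
one of the messages that the flow equations account for could be received. -/
theorem allFinal_of_stuck (h : Invariant U ids m T c)
    (hstuck : ∀ i, ¬ ∃ c', Step EA i c c') : AllFinal c := by
  have hsend : ∀ i p s, OneDirectionConstant.action (c.state i) ≠ .send p s :=
    fun i p s hact => hstuck i ⟨_, @Step.send EA n _ i c p s hact⟩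
  have hrec : ∀ i next, OneDirectionConstant.action (c.state i) = .receive next →
      ∀ p s, next p = some s → c.pending i p = 0 := fun i next hact p s hs => by
    by_contra hne
    exact hstuck i ⟨_, @Step.receive EA n _ i c next hact p s hs (Nat.pos_of_ne_zero hne)⟩
  have hcomp : ∀ i k, c.state i = .competeReceive k → ∀ p, c.pending i p = 0 :=
    fun i k hk p => hrec i _ (by rw [hk]; rfl) p _ rfl
  have habs : ∀ i, c.state i = .relayAbsorb → c.pending i .one = 0 :=
    fun i hk => hrec i _ (by rw [hk]; rfl) .one _ rfl
  have hrel : ∀ i k, c.state i = .relayReceive k → ∀ p, c.pending i p = 0 :=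
    fun i k hk p => hrec i _ (by rw [hk]; rfl) p _ rfl
  have hother : ∀ i, i ≠ m → (∃ k, c.state i = .competeReceive k) ∨ c.state i = .relayAbsorb ∨
      (∃ k, c.state i = .relayReceive k ∧ k ≠ 2) ∨ c.state i = .nonLeader :=
    fun i hi => cases_of_not_isWinner (hsend i) (h.not_winner i hi) (h.counter i)
  have hmin : (∃ k, c.state m = .competeReceive k) ∨ c.state m = .winReceive₁ ∨
      c.state m = .winLoop ∨ c.state m = .winReceive₃ ∨ c.state m = .leader :=
    cases_of_not_isRelay (hsend m) h.not_relay
  have hle := h.ccwOut_le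
  have hge := h.ccwIn_le
  rcases hmin with ⟨k, hm⟩ | hm | hm | hm | hm
  · -- Everyone waits in the competing loop, and `n` clockwise messages are pending.
    exfalso
    have hall : ∀ i, ∃ k, c.state i = .competeReceive k := fun i => by
      by_cases hi : i = m
      · exact ⟨k, hi ▸ hm⟩
      · have h1 := hle i
        rw [hm] at h1
        rcases hother i hi with ⟨k, h2⟩ | h2 | ⟨k, h2, -⟩ | h2
        · exact ⟨k, h2⟩
        all_goals rw [h2] at h1; simp [State.ccwOut] at h1
    have h1 := h.sum_pending
    rw [Finset.sum_eq_zero fun i _ => ?_, Finset.sum_congr rfl fun i _ => ?_,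
      Finset.sum_const (1 : ℤ)] at h1
    · exact NeZero.ne n (by simpa using h1.symm)
    · obtain ⟨k, hk⟩ := hall i
      rw [hk]
      rfl
    · obtain ⟨k, hk⟩ := hall i
      rw [hcomp i k hk]
      rfl
  · -- The first counter-clockwise message is pending at a process in the competing loop.
    exfalso
    have := h.ccwOut_eq_of_forall (a := 0) (by rw [hm]; rfl)
      (hrec m _ (by rw [hm]; rfl) .zero _ rfl) fun i hi h1 => ?_
    · rw [hm] at this
      simp [State.ccwOut] at this
    · rcases hother i hi with ⟨k, h2⟩ | h2 | ⟨k, h2, -⟩ | h2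
      · exact ⟨hcomp i k h2 _, by rw [h2]; rfl⟩
      all_goals rw [h2] at h1; simp [State.ccwOut] at h1
  · -- All processes listen on port `1`, so no clockwise message is pending; then no process waits
    -- for one to absorb, and the second counter-clockwise message is pending in the relay loop.
    exfalso
    have hpend : ∀ i, c.pending i .one = 0 := fun i => by
      by_cases hi : i = m
      · exact hrec i _ (by rw [hi, hm]; rfl) .one _ rfl
      · have h1 := hle i
        rw [hm] at h1
        rcases hother i hi with ⟨k, h2⟩ | h2 | ⟨k, h2, -⟩ | h2
        · exact hcomp i k h2 _
        · exact habs i h2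
        · exact hrel i k h2 _
        · rw [h2] at h1
          simp [State.ccwOut] at h1
    have hnn : ∀ i, 0 ≤ State.cwSurplus (c.state i) := fun i => by
      by_cases hi : i = m
      · rw [hi, hm]
        simp [State.cwSurplus]
      · rcases hother i hi with ⟨k, h2⟩ | h2 | ⟨k, h2, -⟩ | h2 <;> rw [h2] <;>
          simp [State.cwSurplus]
    have hzero : ∀ i, State.cwSurplus (c.state i) = 0 := fun i => by
      have h1 := h.sum_pending
      rw [Finset.sum_eq_zero fun i _ => by rw [hpend i]; rfl] at h1
      exact (Finset.sum_eq_zero_iff_of_nonneg fun i _ => hnn i).1 h1.symm i (Finset.mem_univ i)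
    have := h.ccwOut_eq_of_forall (a := 1) (by rw [hm]; rfl)
      (hrec m _ (by rw [hm]; rfl) .zero _ rfl) fun i hi h1 => ?_
    · rw [hm] at this
      simp [State.ccwOut] at this
    · have h3 := hzero i
      rcases hother i hi with ⟨k, h2⟩ | h2 | ⟨k, h2, -⟩ | h2
      · rw [h2] at h1
        simp [State.ccwOut] at h1
      · rw [h2] at h3
        simp [State.cwSurplus] at h3
      · refine ⟨hrel i k h2 _, ?_⟩
        rw [h2] at h1 ⊢
        exact h1
      · rw [h2] at h1
        simp [State.ccwOut] at h1
  · -- The third counter-clockwise message is pending at a process in the relay loop.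
    exfalso
    have := h.ccwOut_eq_of_forall (a := 2) (by rw [hm]; rfl)
      (hrec m _ (by rw [hm]; rfl) .zero _ rfl) fun i hi h1 => ?_
    · rw [hm] at this
      simp [State.ccwOut] at this
    · rcases hother i hi with ⟨k, h2⟩ | h2 | ⟨k, h2, -⟩ | h2
      · rw [h2] at h1
        simp [State.ccwOut] at h1
      · rw [h2] at h1
        simp [State.ccwOut] at h1
      · refine ⟨hrel i k h2 _, ?_⟩
        rw [h2] at h1 ⊢
        exact h1
      · rw [h2] at h1
        simp [State.ccwOut] at h1
  · intro i
    by_cases hi : i = m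
    · exact ⟨.leader, by subst hi; exact congrArg OneDirectionConstant.action hm⟩
    · have h1 := hge i
      have h3 := hle i
      rw [hm] at h1 h3
      rcases hother i hi with ⟨k, h2⟩ | h2 | ⟨k, h2, h4⟩ | h2
      · rw [h2] at h1
        simp [State.ccwIn, State.ccwOut] at h1
      · rw [h2] at h1
        simp [State.ccwIn, State.ccwOut] at h1
      · rw [h2] at h1 h3
        simp only [State.ccwIn, State.ccwOut] at h1 h3
        omega
      · exact ⟨.nonLeader, congrArg OneDirectionConstant.action h2⟩

theorem state_min_of_allFinal (h : Invariant U ids m T c) (hf : AllFinal c) :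
    c.state m = .leader :=
  let ⟨_, ho⟩ := hf m
  eq_leader_of_action_halt ho h.not_relay

theorem state_of_allFinal (h : Invariant U ids m T c) (hf : AllFinal c) {i : Fin n}
    (hi : i ≠ m) : c.state i = .nonLeader :=
  let ⟨_, ho⟩ := hf i
  eq_nonLeader_of_action_halt ho (h.not_winner i hi)

theorem state_cases_of_allFinal (h : Invariant U ids m T c) (hf : AllFinal c) (i : Fin n) :
    c.state i = .leader ∨ c.state i = .nonLeader := by
  by_cases hi : i = m
  · exact .inl (hi ▸ h.state_min_of_allFinal hf)
  · exact .inr (h.state_of_allFinal hf hi)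

theorem hasOutput_leader (h : Invariant U ids m T c) (hf : AllFinal c) :
    HasOutput c m .leader :=
  congrArg OneDirectionConstant.action (h.state_min_of_allFinal hf)

theorem hasOutput_nonLeader (h : Invariant U ids m T c) (hf : AllFinal c) {i : Fin n}
    (hi : i ≠ m) : HasOutput c i .nonLeader :=
  congrArg OneDirectionConstant.action (h.state_of_allFinal hf hi)

theorem hasOutput_leader_iff (h : Invariant U ids m T c) (hf : AllFinal c) (i : Fin n) :
    HasOutput c i .leader ↔ i = m := by
  refine ⟨fun hl => ?_, fun hi => hi ▸ h.hasOutput_leader hf⟩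
  by_contra hi
  have h1 := (h.hasOutput_nonLeader hf hi).symm.trans hl
  simp at h1

theorem ccwSent_of_allFinal (h : Invariant U ids m T c) (hf : AllFinal c) (i : Fin n) :
    ccwSent c i = 3 := by
  refine (h.ccw_sent i).trans ?_
  rcases h.state_cases_of_allFinal hf i with h1 | h1 <;> rw [h1] <;> rfl

theorem quiescent_of_allFinal (h : Invariant U ids m T c) (hf : AllFinal c) : Quiescent c := by
  intro i p
  cases p with
  | zero =>
    have h1 := h.ccw_flow i
    rcases h.state_cases_of_allFinal hf i with h2 | h2 <;>
      rcases h.state_cases_of_allFinal hf (i + 1) with h3 | h3 <;> rw [h2, h3] at h1 <;>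
      simpa [State.ccwIn, State.ccwOut] using h1
  | one =>
    refine h.all_pending_one_eq_zero (fun j => ?_) i
    rcases h.state_cases_of_allFinal hf j with h1 | h1 <;> rw [h1] <;> simp [State.cwSurplus]

theorem ccwOut_le_three (h : Invariant U ids m T c) (i : Fin n) :
    State.ccwOut (c.state i) ≤ 3 :=
  (h.ccwOut_le i).trans (OneDirectionConstant.ccwOut_le_three h.not_relay)

theorem totalSent_le (h : Invariant U ids m T c) : totalSent c ≤ n * (T + 2 * n + 3) := by
  have : ∀ i, cwSent c i + ccwSent c i ≤ T + 2 * n + 3 := fun i => by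
    have h1 := h.bound i
    have h2 := h.ccw_sent i
    have h3 := h.ccwOut_le_three i
    unfold cwSent ccwSent
    omega
  simpa [totalSent] using Finset.sum_le_card_nsmul Finset.univ _ _ fun i _ => this i

end Invariant

/-! ### Termination -/

section Termination

variable {n : ℕ} [NeZero n] {U : ℕ} {ids : Fin n → ℕ} {m : Fin n} {T : ℕ} {c c' : Config EA n}

/-- The number of actions performed so far: the messages sent by the processes plus the messages
received by them, the latter being determined by the program points. -/
def actionCount (c : Config EA n) : ℤ :=
  ∑ i, (2 * (c.sent i .zero : ℤ) - State.cwSurplus (c.state i) + State.ccwOut (c.state i) +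
    State.ccwIn (c.state i))

theorem actionCount_step {i : Fin n} (h : Step EA i c c') :
    actionCount c' = actionCount c + 1 := by
  have key : ∀ j, (2 * (c'.sent j .zero : ℤ) - State.cwSurplus (c'.state j) +
      State.ccwOut (c'.state j) + State.ccwIn (c'.state j)) =
      (2 * (c.sent j .zero : ℤ) - State.cwSurplus (c.state j) + State.ccwOut (c.state j) +
        State.ccwIn (c.state j)) + if j = i then 1 else 0 := by
    intro j
    by_cases hj : j = i
    · subst hj
      cases h with
      | send p s hact =>
        have hs : SendStep (c.state j) p s := sendStep_of_action hact
        have h1 := hs.cwSurplus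
        have h2 := hs.ccwOut
        have h3 := hs.ccwIn
        cases p <;> simp at h1 h2 ⊢ <;> omega
      | receive next hact p s hs' hp =>
        have hs : ReceiveStep (c.state j) p s := receiveStep_of_action hact hs'
        have h1 := hs.cwSurplus
        have h2 := hs.ccwOut
        have h3 := hs.ccwIn
        cases p <;> simp at h1 h3 ⊢ <;> omega
    · cases h <;> simp [hj]
  unfold actionCount
  rw [Finset.sum_congr rfl fun j _ => key j, Finset.sum_add_distrib]
  simp

theorem Invariant.actionCount_le (h : Invariant U ids m T c) :
    actionCount c ≤ n * (2 * (T + 2 * n) + 7) := by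
  have : ∀ i, 2 * (c.sent i .zero : ℤ) - State.cwSurplus (c.state i) +
      State.ccwOut (c.state i) + State.ccwIn (c.state i) ≤ 2 * (T + 2 * n) + 7 := fun i => by
    have h1 := h.bound i
    have h2 := h.ccwOut_le_three i
    have h3 := h.ccwOut_le_three (i + 1)
    have h4 := h.ccw_flow i
    have h5 := neg_one_le_cwSurplus (c.state i)
    omega
  simpa [actionCount] using Finset.sum_le_card_nsmul Finset.univ _ _ fun i _ => this i

/-- A quantity that grows with every step and is bounded along an execution forces the execution
to reach a configuration in which no process can act. -/
theorem exists_stuck {A : Algorithm} {e : ℕ → Config A n} (he : A.IsExecution U ids e)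
    (f : Config A n → ℤ) (hf : ∀ i c c', A.Step i c c' → f c < f c') (B : ℤ)
    (hB : ∀ t, f (e t) ≤ B) : ∃ t, ∀ i, ¬ ∃ c, A.Step i (e t) c := by
  obtain ⟨v, ⟨t, rfl⟩, hv⟩ := Int.exists_greatest_of_bdd (P := fun v => ∃ t, f (e t) = v)
    ⟨B, by rintro _ ⟨t, rfl⟩; exact hB t⟩ ⟨_, 0, rfl⟩
  have hconst : ∀ k, e (t + k) = e t := by
    intro k
    induction k with
    | zero => rfl
    | succ k ih =>
      rcases he.next (t + k) with h | ⟨i, h⟩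
      · exact h.trans ih
      · have h1 := hf _ _ _ h
        have h2 := hv _ ⟨t + (k + 1), rfl⟩
        rw [ih] at h1
        exact absurd h1 (not_lt.2 h2)
  refine ⟨t, fun i => ?_⟩
  obtain ⟨t', ht, h⟩ := he.fair i t
  obtain ⟨k, rfl⟩ := Nat.exists_eq_add_of_le ht
  rcases h with h | h
  · rwa [hconst] at h
  · have h1 := hf _ _ _ h
    rw [add_assoc, hconst, hconst] at h1
    exact absurd h1 (lt_irrefl _)

end Termination

theorem exists_eq_minId {n : ℕ} [NeZero n] {ids : Fin n → ℕ} (hinj : Function.Injective ids) :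
    ∃ m, ids m = minId ids ∧ ∀ i, i ≠ m → ids m < ids i := by
  obtain ⟨m, -, hm⟩ := Finset.exists_mem_eq_inf' (Finset.univ_nonempty (α := Fin n)) ids
  refine ⟨m, hm.symm, fun i hi => lt_of_le_of_ne ?_ fun h => hi (hinj h.symm)⟩
  rw [← hm]
  exact Finset.inf'_le _ (Finset.mem_univ i)

theorem Invariant.of_execution {n : ℕ} [NeZero n] {U : ℕ} {ids : Fin n → ℕ} {m : Fin n}
    (hn : n ≤ U) (hm : ∀ i, i ≠ m → ids m < ids i) {e : ℕ → Config EA n}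
    (he : IsExecution EA U ids e) (t : ℕ) : Invariant U ids m (U * ids m) (e t) := by
  induction t with
  | zero => rw [he.start]; exact Invariant.initial hn rfl hm
  | succ t ih =>
    rcases he.next t with h | ⟨i, h⟩
    · rwa [h]
    · exact ih.step hn rfl hm h

end ContentOblivious

open ContentOblivious ContentOblivious.Algorithm
theorem theorem2 :
    electionWithOneDirectionConstant.IsQuiescentLeaderElection ∧
    ∃ C : ℕ, ∀ (n : ℕ) [NeZero n] (U : ℕ) (ids : Fin n → ℕ), n ≤ U → Function.Injective ids →
      ∀ e : ℕ → Config electionWithOneDirectionConstant n,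
        electionWithOneDirectionConstant.IsExecution U ids e →
        (∀ t, AllFinal (e t) →
          (∀ i, HasOutput (e t) i .leader ↔ ids i = minId ids) ∧
          (∀ i, ccwSent (e t) i = 3)) ∧
        (0 < minId ids → ∀ t,
          (∀ i, cwSent (e t) i ≤ C * (U * minId ids)) ∧
          totalSent (e t) ≤ C * (n * U * minId ids)) := by
  constructor
  · intro n _ U ids hn hinj e he
    obtain ⟨m, -, hm⟩ := exists_eq_minId hinj
    have hinv := Invariant.of_execution hn hm he
    constructor
    · obtain ⟨t, ht⟩ := exists_stuck he actionCount
        (fun i c c' h => by rw [actionCount_step h]; omega) _ fun t => (hinv t).actionCount_le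
      exact ⟨t, (hinv t).allFinal_of_stuck ht⟩
    · exact fun t hf => ⟨⟨m, (hinv t).hasOutput_leader hf,
        fun i hi => (hinv t).hasOutput_nonLeader hf hi⟩, (hinv t).quiescent_of_allFinal hf⟩
  · refine ⟨6, fun n _ U ids hn hinj e he => ?_⟩
    obtain ⟨m, hmin, hm⟩ := exists_eq_minId hinj
    have hinv := Invariant.of_execution hn hm he
    refine ⟨fun t hf => ⟨fun i => ?_, (hinv t).ccwSent_of_allFinal hf⟩, fun hpos t => ?_⟩
    · rw [(hinv t).hasOutput_leader_iff hf, ← hmin, hinj.eq_iff]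
    · rw [← hmin] at hpos ⊢
      have hUT : U ≤ U * ids m := Nat.le_mul_of_pos_right U hpos
      have hn1 : 1 ≤ n := NeZero.one_le
      constructor
      · intro i
        have h1 : cwSent (e t) i ≤ _ := (hinv t).bound i
        omega
      · refine (hinv t).totalSent_le.trans ?_
        calc n * (U * ids m + 2 * n + 3) ≤ n * (6 * (U * ids m)) := by gcongr; omega
          _ = 6 * (n * U * ids m) := by ring
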